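/- Let $k$ be a field and $X$ a set. The $\{R,S\}$-words on $X$ are the elements of the smallest set $\langle\{R,S\};X\rangle$ of finite (possibly empty) formal products of primes, where a prime is either an element of $X$ or an expression $Q(u)$ with $Q\in\{R,S\}$ and $u\in\langle\{R,S\};X\rangle$; the empty product is $1$. Let $k\langle\{R,S\};X\rangle$ be the $k$-vector space with basis $\langle\{R,S\};X\rangle$, with multiplication extending concatenation and with the linear operators $R,S$ extending $u\mapsto R(u)$, $u\mapsto S(u)$. Let $$\mathbb S=\{\,Q(u)Q(v)-Q(R(u)v)-Q(uS(v)) \;:\; Q\in\{R,S\},\ u,v\in\langle\{R,S\};X\rangle\,\},$$ let $Id(\mathbb S)$ be the smallest two-sided ideal of $k\langle\{R,S\};X\rangle$ that contains $\mathbb S$ and is closed under $R$ and $S$, and let $RS(X)=k\langle\{R,S\};X\mid\mathbb S\rangle=k\langle\{R,S\};X\rangle/Id(\mathbb S)$ with the induced operators. A $\star$-word $\pi$ is a $\{R,S\}$-word on $X\cup\{\star\}$, $\star\notin X$, with exactly one occurrence of $\star$, and $\pi|_s$ is the result of replacing $\star$ by the word $s$. Let $\Phi_\infty(X)$, the set of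 Rota–Baxter system words, be the set of words $w\in\langle\{R,S\};X\rangle$ that are not of the form $\pi|_{Q(u)Q(v)}$ with $\pi$ a $\star$-word, $Q\in\{R,S\}$ and $u,v$ words. A Rota–Baxter system is an associative unitary $k$-algebra $A$ with $k$-linear operators $R,S:A\to A$ such that $R(a)R(b)=R(R(a)b+aS(b))$ and $S(a)S(b)=S(R(a)b+aS(b))$ for all $a,b\in A$. Given a well-order on $X$, the Deg-lex order on $\langle\{R,S\};X\rangle$ compares words by degree (the number of occurrences of elements of $X$ and of operators), then by the number of primes, then lexicographically by the primes from left to right; primes are compared by degree, and for equal degree: elements of $X$ by the order of $X$; $x<R(1)$ and $x<S(1)$ for $x\in X$; and $Q(u)$, $Q'(v)$ by comparing the pairs $(Q,u)$, $(Q',v)$ lexicographically, with $S<R$ and $u,v$ compared in the Deg-lex order. Let $Irr(\mathbb S)$ be the set of words that are not of the form $\pi|_{\bar s}$ with $\pi$ a $\star$-word and $\bar s$ the leading (largest) word of some $s\in\mathbb S$. Theorem. $RS(X)$ is the free Rota–Baxter system on $X$: it is a Rota–Baxter system, and every map from $X$ to a Rota–Baxter system $A$ extends uniquely to a unital $k$-algebra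 homomorphism $RS(X)\to A$ commuting with $R$ and $S$. For every well-order on $X$ one has $Irr(\mathbb S)=\Phi_\infty(X)$. The classes of the words in $\Phi_\infty(X)$ are pairwise distinct and form a $k$-linear basis of $RS(X)$. -/

import Mathlib

noncomputable section

namespace RotaBaxter

/-- The operator symbols `Ω = {R, S}`, both unary. -/
inductive Op : Type
  | R
  | S

/-- The `Ω`-words `⟨{R, S}; X⟩` on `X`. A word is a finite product of primes, a prime being a letter
`x ∈ X` or `Q(u)` with `Q ∈ {R, S}` and `u` a word. So a word is the empty word `1`, or `x · w`, or
`Q(u) · w`, where the first factor is the first prime in the canonical form. -/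
inductive Word (X : Type*) : Type _
  | nil : Word X
  | consVar : X → Word X → Word X
  | consOp : Op → Word X → Word X → Word X

namespace Word

variable {X : Type*}

/-- Concatenation. -/
def append : Word X → Word X → Word X
  | nil, w => w
  | consVar x u, w => consVar x (append u w)
  | consOp Q v u, w => consOp Q v (append u w)

theorem append_nil (u : Word X) : append u nil = u := by
  induction u with
  | nil => rfl
  | consVar x u ih => simp [append, ih]
  | consOp Q v u _ ih => simp [append, ih]

theorem append_assoc (u v w : Word X) : append (append u v) w = append u (append v w) := by
  induction u with
  | nil => rfl
  | consVar x u ih => simp [append, ih]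
  | consOp Q v u _ ih => simp [append, ih]

/-- The words form a monoid under concatenation. -/
instance : Monoid (Word X) where
  one := nil
  mul := append
  one_mul _ := rfl
  mul_one := append_nil
  mul_assoc := append_assoc

/-- The letter `x`, as a word. -/
def var (x : X) : Word X := consVar x 1

/-- The word `Q(u)`. -/
def op (Q : Op) (u : Word X) : Word X := consOp Q u 1

/-- The number of occurrences of letters and of operators. -/
def deg : Word X → ℕ
  | nil => 0
  | consVar _ w => 1 + deg w
  | consOp _ u w => 1 + deg u + deg w

/-- The breadth: the number of primes in the canonical form. -/
def bre : Word X → ℕ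
  | nil => 0
  | consVar _ w => 1 + bre w
  | consOp _ _ w => 1 + bre w

/-- The number of occurrences of `⋆`, in a word on `X ∪ {⋆}`; here `none` is the symbol `⋆`. -/
def starCount : Word (Option X) → ℕ
  | nil => 0
  | consVar none w => 1 + starCount w
  | consVar (some _) w => starCount w
  | consOp _ u w => starCount u + starCount w

/-- `subst s π` replaces every `⋆` in `π` by the word `s`. -/
def subst (s : Word X) : Word (Option X) → Word X
  | nil => 1
  | consVar none w => s * subst s w
  | consVar (some x) w => var x * subst s w
  | consOp Q u w => op Q (subst s u) * subst s w

end Word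

/-- The `⋆`-`Ω`-words on `X`: words on `X ∪ {⋆}` with exactly one occurrence of `⋆`. -/
def StarWord (X : Type*) : Type _ := {π : Word (Option X) // π.starCount = 1}

/-- `π|_s`, for a `⋆`-word `π` and a word `s`. -/
def StarWord.plug {X : Type*} (π : StarWord X) (s : Word X) : Word X := Word.subst s π.1

/-- The Deg-lex order: `DegLex lt u v` means `u < v`, where `lt` is the order of `X`. Words are
compared by degree, then by breadth, then lexicographically by their primes. Primes (the words of
breadth one) are compared by degree; for equal degree, letters are compared by `lt`, a letter is
below `R(1)` and `S(1)`, and `Q(u)`, `Q'(v)` are compared lexicographically as pairs `(Q, u)`,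
`(Q', v)`, with `S < R`. -/
inductive DegLex {X : Type*} (lt : X → X → Prop) : Word X → Word X → Prop
  | deg {u v : Word X} : u.deg < v.deg → DegLex lt u v
  | bre {u v : Word X} : u.deg = v.deg → u.bre < v.bre → DegLex lt u v
  | lex {p q : Word X} (a u v : Word X) : p.bre = 1 → q.bre = 1 → u.bre = v.bre →
      (a * p * u).deg = (a * q * v).deg → DegLex lt p q → DegLex lt (a * p * u) (a * q * v)
  | var_var {x y : X} : lt x y → DegLex lt (Word.var x) (Word.var y)
  | var_op (x : X) (Q : Op) : DegLex lt (Word.var x) (Word.op Q 1)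
  | op_op {u v : Word X} : u.deg = v.deg → DegLex lt (Word.op Op.S u) (Word.op Op.R v)
  | op_arg (Q : Op) {u v : Word X} : u.deg = v.deg → DegLex lt u v →
      DegLex lt (Word.op Q u) (Word.op Q v)

section Algebra

variable (k : Type*) [Field k] (X : Type*)

/-- The free associative unitary `{R, S}`-algebra `k⟨{R, S}; X⟩`: the linear space spanned by the
words, with the product extending concatenation. -/
abbrev FreeOmega : Type _ := MonoidAlgebra k (Word X)

variable {X}

/-- A word, as an element of `k⟨{R, S}; X⟩`. -/
def FreeOmega.word (w : Word X) : FreeOmega k X := MonoidAlgebra.single w 1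

variable (X)

/-- The operator `Q` on `k⟨{R, S}; X⟩`: the linear extension of `u ↦ Q(u)`. -/
def FreeOmega.op (Q : Op) : FreeOmega k X →ₗ[k] FreeOmega k X :=
  MonoidAlgebra.mapDomainLinearMap k k (Word.op Q)

variable {k X}

/-- `w` is the leading word of `f` with respect to the Deg-lex order. -/
def IsLeadingWord (lt : X → X → Prop) (f : FreeOmega k X) (w : Word X) : Prop :=
  w ∈ f.coeff.support ∧ ∀ v ∈ f.coeff.support, v ≠ w → DegLex lt v w

/-- `Irr(𝕊)`: the words not of the form `π|_s̄` with `π` a `⋆`-word and `s̄` the leading word of some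
`s ∈ 𝕊`. -/
def Irr (lt : X → X → Prop) (𝕊 : Set (FreeOmega k X)) : Set (Word X) :=
  {w | ∀ (π : StarWord X), ∀ s ∈ 𝕊, ∀ sbar : Word X, IsLeadingWord lt s sbar → w ≠ π.plug sbar}

/-- An `Ω`-ideal: a two-sided ideal closed under the operators `R` and `S`. -/
def IsOmegaIdeal (I : TwoSidedIdeal (FreeOmega k X)) : Prop :=
  ∀ (Q : Op), ∀ f ∈ I, FreeOmega.op k X Q f ∈ I

/-- `Id(𝕊)`: the `Ω`-ideal generated by `𝕊`. -/
def omegaIdeal (𝕊 : Set (FreeOmega k X)) : TwoSidedIdeal (FreeOmega k X) :=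
  sInf {I | IsOmegaIdeal I ∧ 𝕊 ⊆ I}

theorem isOmegaIdeal_omegaIdeal (𝕊 : Set (FreeOmega k X)) : IsOmegaIdeal (omegaIdeal 𝕊) := by
  intro Q f hf
  rw [omegaIdeal, TwoSidedIdeal.mem_sInf] at hf ⊢
  exact fun I hI => hI.1 Q f (hf I hI)

/-- `k⟨{R, S}; X | 𝕊⟩ = k⟨{R, S}; X⟩ / Id(𝕊)`, as a `k`-algebra. -/
abbrev OmegaQuotient (𝕊 : Set (FreeOmega k X)) : Type _ := (omegaIdeal 𝕊).ringCon.Quotient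

/-- The quotient map. -/
def OmegaQuotient.mk (𝕊 : Set (FreeOmega k X)) : FreeOmega k X →ₐ[k] OmegaQuotient 𝕊 :=
  RingCon.mkₐ k (omegaIdeal 𝕊).ringCon

/-- The operator induced by `Q` on the quotient. -/
def OmegaQuotient.op (𝕊 : Set (FreeOmega k X)) (Q : Op) :
    OmegaQuotient 𝕊 →ₗ[k] OmegaQuotient 𝕊 where
  toFun := Quotient.map' (FreeOmega.op k X Q) (by
    intro f g h
    have h' : f - g ∈ omegaIdeal 𝕊 := ((omegaIdeal 𝕊).rel_iff f g).1 h
    refine ((omegaIdeal 𝕊).rel_iff _ _).2 ?_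
    rw [← map_sub]
    exact isOmegaIdeal_omegaIdeal 𝕊 Q _ h')
  map_add' := by
    rintro ⟨f⟩ ⟨g⟩
    exact congrArg (OmegaQuotient.mk 𝕊) (map_add (FreeOmega.op k X Q) f g)
  map_smul' := by
    rintro c ⟨f⟩
    exact congrArg (OmegaQuotient.mk 𝕊) (map_smul (FreeOmega.op k X Q) c f)

theorem OmegaQuotient.op_mk (𝕊 : Set (FreeOmega k X)) (Q : Op) (f : FreeOmega k X) :
    OmegaQuotient.op 𝕊 Q (OmegaQuotient.mk 𝕊 f) = OmegaQuotient.mk 𝕊 (FreeOmega.op k X Q f) :=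
  rfl

/-- `(A; R, S)` is a Rota-Baxter system. -/
structure IsRotaBaxterSystem {A : Type*} [Ring A] [Algebra k A] (R S : A →ₗ[k] A) : Prop where
  mul_R : ∀ a b, R a * R b = R (R a * b + a * S b)
  mul_S : ∀ a b, S a * S b = S (R a * b + a * S b)

variable (k X)

/-- The set `𝕊` of the elements `Q(u)Q(v) - Q(R(u)v) - Q(uS(v))` with `Q ∈ {R, S}` and `u`, `v`
words. -/
def rbRelations : Set (FreeOmega k X) :=
  {f | ∃ (Q : Op) (u v : Word X), f = FreeOmega.word k (Word.op Q u * Word.op Q v)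
    - FreeOmega.word k (Word.op Q (Word.op Op.R u * v))
    - FreeOmega.word k (Word.op Q (u * Word.op Op.S v))}

/-- `RS(X) = k⟨{R, S}; X | 𝕊⟩`. -/
abbrev RS : Type _ := OmegaQuotient (rbRelations k X)

variable {X}

/-- The class in `RS(X)` of a word. -/
def RS.word (w : Word X) : RS k X := OmegaQuotient.mk (rbRelations k X) (FreeOmega.word k w)

variable (X)

/-- The operators `R` and `S` of `RS(X)`. -/
def RS.op (Q : Op) : RS k X →ₗ[k] RS k X := OmegaQuotient.op (rbRelations k X) Q

/-- `Φ_∞(X)`, the Rota-Baxter system words: the words not of the form `π|_{Q(u)Q(v)}` with `π` a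
`⋆`-word, `Q ∈ {R, S}` and `u`, `v` words. -/
def rbWords : Set (Word X) :=
  {w | ∀ (π : StarWord X) (Q : Op) (u v : Word X), w ≠ π.plug (Word.op Q u * Word.op Q v)}

end Algebra

end RotaBaxter

end

/-! The basis statement is proved by letting `RS(X)` act on the space of all words, instead of
resolving the compositions of the relations. A word is normal if it has no subword `Q(u)Q(v)`. For
an endomorphism `T` of `k⟨{R, S}; X⟩`, `rbEnd` defines `Q(T)` by what the relations force: `Q(T)`
applied to `Q(v)w` is `Q(R(T)v + T S(v))w`, a recursion on the first prime, and any other word only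
gets `Q(T 1)` put in front. These operators make the endomorphism algebra a Rota-Baxter system
(`rbEnd_mul_rbEnd`), so the universal property gives an action of `RS(X)`.

Acting on `1` fixes the normal words, which gives independence. Conversely, `wordEnd u 1` is a
combination of normal words (`wordEnd_mem_normalSpan`) and is congruent to `u` (`mk_wordEnd`), which
gives spanning. -/

noncomputable section

namespace RotaBaxter

/-! ### Words, and normality as a recursive condition -/

namespace Word

variable {X : Type*}

theorem consVar_eq (x : X) (w : Word X) : consVar x w = var x * w := rfl

theorem consOp_eq (Q : Op) (u w : Word X) : consOp Q u w = op Q u * w := rfl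

theorem deg_mul (u v : Word X) : (u * v).deg = u.deg + v.deg := by
  induction u with
  | nil => exact (Nat.zero_add _).symm
  | consVar x u ih =>
    change 1 + (u * v).deg = 1 + u.deg + v.deg
    omega
  | consOp Q z u _ ih =>
    change 1 + z.deg + (u * v).deg = 1 + z.deg + u.deg + v.deg
    omega

theorem bre_mul (u v : Word X) : (u * v).bre = u.bre + v.bre := by
  induction u with
  | nil => exact (Nat.zero_add _).symm
  | consVar x u ih =>
    change 1 + (u * v).bre = 1 + u.bre + v.bre
    omega
  | consOp Q z u _ ih =>
    change 1 + (u * v).bre = 1 + u.bre + v.bre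
    omega

theorem deg_op (Q : Op) (u : Word X) : (op Q u).deg = 1 + u.deg := rfl

theorem bre_op (Q : Op) (u : Word X) : (op Q u).bre = 1 := rfl

/-- The first prime of the word is of the form `Q(u)`. -/
def StartsWith (Q : Op) : Word X → Prop
  | nil => False
  | consVar _ _ => False
  | consOp Q' _ _ => Q = Q'

/-- The words with no subword `Q(u)Q(v)`, described recursively along the first prime. -/
def IsNormal : Word X → Prop
  | nil => True
  | consVar _ w => IsNormal w
  | consOp Q u w => IsNormal u ∧ IsNormal w ∧ ¬ StartsWith Q w

/-- A word on `X`, as a word on `X ∪ {⋆}`. -/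
def lift : Word X → Word (Option X)
  | nil => nil
  | consVar x w => consVar (some x) (lift w)
  | consOp Q u w => consOp Q (lift u) (lift w)

theorem starCount_lift (w : Word X) : w.lift.starCount = 0 := by
  induction w with
  | nil => rfl
  | consVar x w ih => exact ih
  | consOp Q u w ihu ihw => simp [lift, starCount, ihu, ihw]

theorem subst_lift (s w : Word X) : subst s w.lift = w := by
  induction w with
  | nil => rfl
  | consVar x w ih =>
    simp only [lift, subst, ih]
    rfl
  | consOp Q u w ihu ihw =>
    simp only [lift, subst, ihu, ihw]
    rfl

theorem not_isNormal_subst (Q : Op) (u v : Word X) (π : Word (Option X)) (h : π.starCount = 1) :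
    ¬ IsNormal (subst (op Q u * op Q v) π) := by
  induction π with
  | nil => simp [starCount] at h
  | consVar x w ih =>
    cases x with
    | none =>
      intro hn
      -- At the star the word is `Q(u)` followed by a word that starts with `Q(v)`.
      exact hn.2.2 rfl
    | some x => exact ih h
  | consOp Q' a w iha ihw =>
    rintro ⟨h₁, h₂, -⟩
    simp only [starCount] at h
    rcases Nat.eq_zero_or_pos a.starCount with ha | ha
    · exact ihw (by omega) h₂
    · exact iha (by omega) h₁

theorem exists_subst_of_not_isNormal (w : Word X) (h : ¬ IsNormal w) :
    ∃ (π : Word (Option X)) (Q : Op) (u v : Word X),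
      π.starCount = 1 ∧ w = subst (op Q u * op Q v) π := by
  induction w with
  | nil => exact absurd trivial h
  | consVar x w ih =>
    obtain ⟨π, Q, u, v, hπ, rfl⟩ := ih h
    exact ⟨consVar (some x) π, Q, u, v, hπ, rfl⟩
  | consOp Q a w iha ihw =>
    by_cases ha : IsNormal a
    · by_cases hw : IsNormal w
      · have hs : StartsWith Q w := by
          by_contra hs
          exact h ⟨ha, hw, hs⟩
        cases w with
        | nil => exact hs.elim
        | consVar x w => exact hs.elim
        | consOp Q' b w =>
          obtain rfl : Q = Q' := hs
          -- Both factors are normal, so the forbidden pair is the first two primes and the star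
          -- stands in front of the remaining `w`.
          refine ⟨consVar none w.lift, Q, a, b, by simp [starCount, starCount_lift], ?_⟩
          simp only [subst, subst_lift]
          rfl
      · obtain ⟨π, Q', u, v, hπ, rfl⟩ := ihw hw
        refine ⟨consOp Q a.lift π, Q', u, v, by simp [starCount, starCount_lift, hπ], ?_⟩
        simp only [subst, subst_lift]
        rfl
    · obtain ⟨π, Q', u, v, hπ, rfl⟩ := iha ha
      refine ⟨consOp Q π w.lift, Q', u, v, by simp [starCount, starCount_lift, hπ], ?_⟩
      simp only [subst, subst_lift]
      rfl

end Word

theorem mem_rbWords_iff {X : Type*} (w : Word X) : w ∈ rbWords X ↔ w.IsNormal := by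
  constructor
  · intro h
    by_contra hn
    obtain ⟨π, Q, u, v, hπ, hw⟩ := w.exists_subst_of_not_isNormal hn
    exact h ⟨π, hπ⟩ Q u v hw
  · rintro h π Q u v rfl
    exact Word.not_isNormal_subst Q u v π.1 π.2 h

/-! ### Leading words of the relations -/

section Order

variable {X : Type*} {lt : X → X → Prop}

/-- This bound is all that is needed of the order: it excludes a second leading word without a proof
that the order is total or asymmetric. -/
theorem DegLex.deg_le_and_bre_le {u v : Word X} (h : DegLex lt u v) :
    u.deg ≤ v.deg ∧ (u.deg = v.deg → u.bre ≤ v.bre) := by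
  cases h with
  | deg h => exact ⟨h.le, fun h' => absurd h' h.ne⟩
  | bre h h' => exact ⟨h.le, fun _ => h'.le⟩
  | lex a u v hp hq huv hd _ =>
    refine ⟨hd.le, fun _ => ?_⟩
    simp only [Word.bre_mul]
    omega
  | var_var _ => exact ⟨le_rfl, fun _ => le_rfl⟩
  | var_op _ _ => exact ⟨le_rfl, fun _ => le_rfl⟩
  | op_op h =>
    simp only [Word.deg_op, Word.bre_op]
    omega
  | op_arg _ h _ =>
    simp only [Word.deg_op, Word.bre_op]
    omega

variable {k : Type*} [Field k]

/-- All three words have degree `2 + deg u + deg v`, but `Q(u)Q(v)` has breadth two and the other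
two have breadth one. So the first word cannot cancel, and breadth decides. -/
theorem isLeadingWord_iff (Q : Op) (u v w : Word X) :
    IsLeadingWord lt (FreeOmega.word k (Word.op Q u * Word.op Q v)
      - FreeOmega.word k (Word.op Q (Word.op Op.R u * v))
      - FreeOmega.word k (Word.op Q (u * Word.op Op.S v))) w ↔ w = Word.op Q u * Word.op Q v := by
  classical
  set p := Word.op Q u * Word.op Q v with hp
  set a := Word.op Q (Word.op Op.R u * v) with ha
  set b := Word.op Q (u * Word.op Op.S v) with hb
  have hpd : p.deg = 2 + u.deg + v.deg := by simp only [hp, Word.deg_mul, Word.deg_op]; omega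
  have had : a.deg = 2 + u.deg + v.deg := by simp only [ha, Word.deg_mul, Word.deg_op]; omega
  have hbd : b.deg = 2 + u.deg + v.deg := by simp only [hb, Word.deg_mul, Word.deg_op]; omega
  have hpb : p.bre = 2 := by simp only [hp, Word.bre_mul, Word.bre_op]
  have hab : a.bre = 1 := rfl
  have hbb : b.bre = 1 := rfl
  have hap : a ≠ p := fun h => by rw [h] at hab; omega
  have hbp : b ≠ p := fun h => by rw [h] at hbb; omega
  set f := FreeOmega.word k p - FreeOmega.word k a - FreeOmega.word k b with hf
  have hmem : p ∈ f.coeff.support := by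
    simp [hf, FreeOmega.word, hap, hbp]
  have hsupp : ∀ z ∈ f.coeff.support, z ≠ p → z = a ∨ z = b := by
    intro z hz hzp
    by_contra! hcon
    simp [hf, FreeOmega.word, hcon.1.symm, hcon.2.symm, hzp.symm] at hz
  have hlow : ∀ z, z = a ∨ z = b → z.deg = p.deg ∧ z.bre < p.bre := by
    rintro z (rfl | rfl)
    · exact ⟨by omega, by omega⟩
    · exact ⟨by omega, by omega⟩
  constructor
  · rintro ⟨hw, hmax⟩
    by_contra hne
    obtain ⟨h₁, h₂⟩ := hlow w (hsupp w hw hne)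
    have := (hmax p hmem (Ne.symm hne)).deg_le_and_bre_le.2 h₁.symm
    omega
  · rintro rfl
    refine ⟨hmem, fun z hz hzp => ?_⟩
    obtain ⟨h₁, h₂⟩ := hlow z (hsupp z hz hzp)
    exact DegLex.bre h₁ h₂

theorem irr_rbRelations (lt : X → X → Prop) : Irr lt (rbRelations k X) = rbWords X := by
  ext w
  constructor
  · intro h π Q u v
    exact h π _ ⟨Q, u, v, rfl⟩ _ ((isLeadingWord_iff Q u v _).2 rfl)
  · rintro h π _ ⟨Q, u, v, rfl⟩ sbar hs
    rw [isLeadingWord_iff] at hs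
    subst hs
    exact h π Q u v

end Order

/-! ### Linear maps on the free algebra, determined on words -/

section FreeOmega

variable {k : Type*} [Field k] {X : Type*}

theorem FreeOmega.word_mul (u v : Word X) :
    FreeOmega.word k (u * v) = FreeOmega.word k u * FreeOmega.word k v := by
  simp [FreeOmega.word, MonoidAlgebra.single_mul_single]

theorem FreeOmega.word_one : FreeOmega.word k (1 : Word X) = 1 := rfl

theorem FreeOmega.op_word (Q : Op) (u : Word X) :
    FreeOmega.op k X Q (FreeOmega.word k u) = FreeOmega.word k (Word.op Q u) :=
  MonoidAlgebra.mapDomainLinearMap_single _ _ _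

theorem FreeOmega.basis_apply (w : Word X) :
    MonoidAlgebra.basis (Word X) k w = FreeOmega.word k w :=
  MonoidAlgebra.basis_apply k w

theorem FreeOmega.linearMap_ext {M : Type*} [AddCommMonoid M] [Module k M]
    {f g : FreeOmega k X →ₗ[k] M}
    (h : ∀ w, f (FreeOmega.word k w) = g (FreeOmega.word k w)) : f = g :=
  (MonoidAlgebra.basis (Word X) k).ext fun w => by simpa only [FreeOmega.basis_apply] using h w

end FreeOmega

/-! ### The universal property -/

section UniversalProperty

variable {k : Type*} [Field k] {X : Type*}

theorem omegaIdeal_le {𝕊 : Set (FreeOmega k X)} {I : TwoSidedIdeal (FreeOmega k X)}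
    (hI : IsOmegaIdeal I) (h : 𝕊 ⊆ I) : omegaIdeal 𝕊 ≤ I :=
  sInf_le ⟨hI, h⟩

theorem mem_omegaIdeal_of_mem {𝕊 : Set (FreeOmega k X)} {f : FreeOmega k X} (h : f ∈ 𝕊) :
    f ∈ omegaIdeal 𝕊 := by
  rw [omegaIdeal, TwoSidedIdeal.mem_sInf]
  exact fun I hI => hI.2 h

theorem OmegaQuotient.mk_eq_zero {𝕊 : Set (FreeOmega k X)} {f : FreeOmega k X}
    (h : f ∈ omegaIdeal 𝕊) : OmegaQuotient.mk 𝕊 f = 0 :=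
  Quotient.sound' (((omegaIdeal 𝕊).rel_iff f 0).2 (by simpa using h))

theorem OmegaQuotient.mk_surjective (𝕊 : Set (FreeOmega k X)) :
    Function.Surjective (OmegaQuotient.mk 𝕊) :=
  RingCon.mkₐ_surjective _

theorem RS.word_mul (u v : Word X) : RS.word k (u * v) = RS.word k u * RS.word k v := by
  simp only [RS.word, FreeOmega.word_mul, map_mul]

theorem RS.word_one : RS.word k (1 : Word X) = 1 := map_one _

theorem RS.op_word (Q : Op) (u : Word X) :
    RS.op k X Q (RS.word k u) = RS.word k (Word.op Q u) := by
  rw [RS.op, RS.word, OmegaQuotient.op_mk, FreeOmega.op_word, RS.word]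

theorem RS.linearMap_ext {M : Type*} [AddCommMonoid M] [Module k M] {f g : RS k X →ₗ[k] M}
    (h : ∀ w, f (RS.word k w) = g (RS.word k w)) : f = g := by
  have := FreeOmega.linearMap_ext (f := f ∘ₗ (OmegaQuotient.mk (rbRelations k X)).toLinearMap)
    (g := g ∘ₗ (OmegaQuotient.mk (rbRelations k X)).toLinearMap) h
  ext a
  obtain ⟨a, rfl⟩ := OmegaQuotient.mk_surjective _ a
  exact LinearMap.congr_fun this a

theorem RS.word_op_mul_word_op (Q : Op) (u v : Word X) :
    RS.word k (Word.op Q u) * RS.word k (Word.op Q v) =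
      RS.word k (Word.op Q (Word.op Op.R u * v)) + RS.word k (Word.op Q (u * Word.op Op.S v)) := by
  have h := OmegaQuotient.mk_eq_zero
    (mem_omegaIdeal_of_mem (𝕊 := rbRelations k X) ⟨Q, u, v, rfl⟩)
  rw [map_sub, map_sub, sub_sub, sub_eq_zero] at h
  rw [← RS.word_mul]
  exact h

theorem RS.op_mul_op (Q : Op) (a b : RS k X) :
    RS.op k X Q a * RS.op k X Q b = RS.op k X Q (RS.op k X Op.R a * b + a * RS.op k X Op.S b) := by
  -- Both sides are bilinear in `a` and `b`, so it suffices to compare them on words, where the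
  -- identity is a defining relation.
  have h : (LinearMap.mul k (RS k X)).compl₁₂ (RS.op k X Q) (RS.op k X Q) =
      ((LinearMap.mul k (RS k X)).compl₁₂ (RS.op k X Op.R) LinearMap.id +
        (LinearMap.mul k (RS k X)).compl₁₂ LinearMap.id (RS.op k X Op.S)).compr₂
        (RS.op k X Q) := by
    refine RS.linearMap_ext fun u => RS.linearMap_ext fun v => ?_
    change RS.op k X Q (RS.word k u) * RS.op k X Q (RS.word k v) =
      RS.op k X Q (RS.op k X Op.R (RS.word k u) * RS.word k v
        + RS.word k u * RS.op k X Op.S (RS.word k v))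
    simp only [map_add, RS.op_word, ← RS.word_mul]
    rw [RS.word_mul, RS.word_op_mul_word_op]
  exact LinearMap.congr_fun₂ h a b

theorem RS.isRotaBaxterSystem : IsRotaBaxterSystem (RS.op k X Op.R) (RS.op k X Op.S) :=
  ⟨RS.op_mul_op Op.R, RS.op_mul_op Op.S⟩

variable {A : Type*} [Ring A] [Algebra k A]

/-- The operator of a Rota-Baxter system `(A; R, S)` named by `Q`. -/
def Op.interp (R S : A →ₗ[k] A) : Op → A →ₗ[k] A
  | Op.R => R
  | Op.S => S

theorem IsRotaBaxterSystem.interp_mul {R S : A →ₗ[k] A} (h : IsRotaBaxterSystem R S) (Q : Op)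
    (a b : A) : Q.interp R S a * Q.interp R S b = Q.interp R S (R a * b + a * S b) := by
  cases Q with
  | R => exact h.mul_R a b
  | S => exact h.mul_S a b

/-- The value of a word in an algebra with two operators. -/
def Word.eval (R S : A →ₗ[k] A) (φ : X → A) : Word X → A
  | nil => 1
  | consVar x w => φ x * eval R S φ w
  | consOp Q u w => Q.interp R S (eval R S φ u) * eval R S φ w

/-- Evaluation of words, as a monoid homomorphism. -/
def Word.evalHom (R S : A →ₗ[k] A) (φ : X → A) : Word X →* A where
  toFun := Word.eval R S φ
  map_one' := rfl
  map_mul' u v := by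
    induction u with
    | nil => exact (one_mul _).symm
    | consVar x u ih =>
      change φ x * Word.eval R S φ (u * v) = φ x * Word.eval R S φ u * Word.eval R S φ v
      rw [ih, mul_assoc]
    | consOp Q z u _ ih =>
      change Q.interp R S (Word.eval R S φ z) * Word.eval R S φ (u * v) =
        Q.interp R S (Word.eval R S φ z) * Word.eval R S φ u * Word.eval R S φ v
      rw [ih, mul_assoc]

theorem Word.evalHom_op (R S : A →ₗ[k] A) (φ : X → A) (Q : Op) (u : Word X) :
    Word.evalHom R S φ (Word.op Q u) = Q.interp R S (Word.evalHom R S φ u) := mul_one _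

theorem Word.evalHom_var (R S : A →ₗ[k] A) (φ : X → A) (x : X) :
    Word.evalHom R S φ (Word.var x) = φ x := mul_one _

/-- Evaluation on `k⟨{R, S}; X⟩`. -/
def FreeOmega.eval (R S : A →ₗ[k] A) (φ : X → A) : FreeOmega k X →ₐ[k] A :=
  MonoidAlgebra.lift k A (Word X) (Word.evalHom R S φ)

theorem FreeOmega.eval_word (R S : A →ₗ[k] A) (φ : X → A) (w : Word X) :
    FreeOmega.eval R S φ (FreeOmega.word k w) = Word.evalHom R S φ w := by
  rw [FreeOmega.eval, FreeOmega.word, MonoidAlgebra.lift_single, one_smul]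

theorem FreeOmega.eval_op (R S : A →ₗ[k] A) (φ : X → A) (Q : Op) (f : FreeOmega k X) :
    FreeOmega.eval R S φ (FreeOmega.op k X Q f) = Q.interp R S (FreeOmega.eval R S φ f) := by
  have h : (FreeOmega.eval R S φ).toLinearMap ∘ₗ FreeOmega.op k X Q =
      Q.interp R S ∘ₗ (FreeOmega.eval R S φ).toLinearMap := by
    refine FreeOmega.linearMap_ext fun w => ?_
    simp only [LinearMap.comp_apply, AlgHom.toLinearMap_apply, FreeOmega.op_word,
      FreeOmega.eval_word, Word.evalHom_op]
  exact LinearMap.congr_fun h f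

/-- The kernel of evaluation is closed under the operators and contains the relations, so minimality
of `Id(𝕊)` applies. -/
theorem IsRotaBaxterSystem.omegaIdeal_le_ker {R S : A →ₗ[k] A} (h : IsRotaBaxterSystem R S)
    (φ : X → A) : omegaIdeal (rbRelations k X) ≤ TwoSidedIdeal.ker (FreeOmega.eval R S φ) := by
  refine omegaIdeal_le (fun Q f hf => ?_) ?_
  · rw [TwoSidedIdeal.mem_ker] at hf ⊢
    rw [FreeOmega.eval_op, hf, map_zero]
  · rintro _ ⟨Q, u, v, rfl⟩
    refine (TwoSidedIdeal.mem_ker _).2 ?_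
    simp only [map_sub, FreeOmega.eval_word, map_mul, Word.evalHom_op, h.interp_mul, map_add]
    rw [sub_sub]
    exact sub_self _

/-- The homomorphism from `RS(X)` to a Rota-Baxter system that extends a map on `X`. -/
def RS.lift {R S : A →ₗ[k] A} (h : IsRotaBaxterSystem R S) (φ : X → A) : RS k X →ₐ[k] A :=
  (omegaIdeal (rbRelations k X)).ringCon.liftₐ (FreeOmega.eval R S φ) fun {f g} hfg => by
    have h' := h.omegaIdeal_le_ker φ (((omegaIdeal (rbRelations k X)).rel_iff f g).1 hfg)
    rw [TwoSidedIdeal.mem_ker, map_sub, sub_eq_zero] at h'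
    exact h'

theorem RS.lift_mk {R S : A →ₗ[k] A} (h : IsRotaBaxterSystem R S) (φ : X → A)
    (f : FreeOmega k X) :
    RS.lift h φ (OmegaQuotient.mk (rbRelations k X) f) = FreeOmega.eval R S φ f := rfl

theorem RS.lift_word {R S : A →ₗ[k] A} (h : IsRotaBaxterSystem R S) (φ : X → A) (w : Word X) :
    RS.lift h φ (RS.word k w) = Word.evalHom R S φ w := by
  rw [RS.word, RS.lift_mk, FreeOmega.eval_word]

theorem RS.lift_op {R S : A →ₗ[k] A} (h : IsRotaBaxterSystem R S) (φ : X → A) (Q : Op)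
    (a : RS k X) : RS.lift h φ (RS.op k X Q a) = Q.interp R S (RS.lift h φ a) := by
  obtain ⟨f, rfl⟩ := OmegaQuotient.mk_surjective _ a
  rw [RS.op, OmegaQuotient.op_mk, RS.lift_mk, RS.lift_mk, FreeOmega.eval_op]

theorem RS.algHom_word {R S : A →ₗ[k] A} {φ : X → A} {f : RS k X →ₐ[k] A}
    (hx : ∀ x, f (RS.word k (Word.var x)) = φ x) (hR : ∀ a, f (RS.op k X Op.R a) = R (f a))
    (hS : ∀ a, f (RS.op k X Op.S a) = S (f a)) (w : Word X) :
    f (RS.word k w) = Word.evalHom R S φ w := by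
  induction w with
  | nil =>
    change f (RS.word k 1) = Word.evalHom R S φ 1
    rw [RS.word_one, map_one, map_one]
  | consVar x w ih =>
    rw [Word.consVar_eq, RS.word_mul, map_mul, map_mul, ih, hx, Word.evalHom_var]
  | consOp Q u w ihu ihw =>
    rw [Word.consOp_eq, RS.word_mul, map_mul, map_mul, ihw, ← RS.op_word, Word.evalHom_op, ← ihu]
    cases Q with
    | R => rw [hR]; rfl
    | S => rw [hS]; rfl

theorem RS.existsUnique_algHom {R S : A →ₗ[k] A} (h : IsRotaBaxterSystem R S) (φ : X → A) :
    ∃! f : RS k X →ₐ[k] A,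
      (∀ x, f (RS.word k (Word.var x)) = φ x) ∧
      (∀ a, f (RS.op k X Op.R a) = R (f a)) ∧
      (∀ a, f (RS.op k X Op.S a) = S (f a)) := by
  refine ⟨RS.lift h φ, ⟨fun x => ?_, RS.lift_op h φ Op.R, RS.lift_op h φ Op.S⟩, ?_⟩
  · rw [RS.lift_word, Word.evalHom_var]
  · rintro g ⟨hx, hR, hS⟩
    refine AlgHom.toLinearMap_injective (RS.linearMap_ext fun w => ?_)
    change g (RS.word k w) = RS.lift h φ (RS.word k w)
    rw [RS.algHom_word hx hR hS, RS.lift_word]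

end UniversalProperty

/-! ### The action on words, and linear independence -/

section Representation

variable (k : Type*) [Field k] (X : Type*)

variable {X} in
open scoped Classical in
/-- The value at a word `w` of the operator by which `Q(T)` acts on `k⟨{R, S}; X⟩`, as a linear
function of the operator `T`. If `w = Q(v)w'`, the leading product `Q(T)Q(v)` is rewritten as
`Q(R(T)v) + Q(T S(v))`; otherwise `Q(T 1)` is put in front of `w`. -/
def rbAction : Word X → Op → Module.End k (FreeOmega k X) →ₗ[k] FreeOmega k X
  | .nil, Q => FreeOmega.op k X Q ∘ₗ LinearMap.applyₗ 1
  | .consVar x w, Q => LinearMap.mulRight k (FreeOmega.word k (.consVar x w)) ∘ₗ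
      FreeOmega.op k X Q ∘ₗ LinearMap.applyₗ 1
  | .consOp Q' v w, Q =>
      if Q = Q' then
        LinearMap.mulRight k (FreeOmega.word k w) ∘ₗ FreeOmega.op k X Q ∘ₗ
          (rbAction v Op.R + LinearMap.applyₗ (FreeOmega.word k (Word.op Op.S v)))
      else
        LinearMap.mulRight k (FreeOmega.word k (.consOp Q' v w)) ∘ₗ
          FreeOmega.op k X Q ∘ₗ LinearMap.applyₗ 1

/-- The operators that make the endomorphisms of the space `k⟨{R, S}; X⟩` a Rota-Baxter system. -/
def rbEnd (Q : Op) : Module.End k (FreeOmega k X) →ₗ[k] Module.End k (FreeOmega k X) :=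
  ((MonoidAlgebra.basis (Word X) k).constr k).toLinearMap ∘ₗ
    LinearMap.pi fun w => rbAction k w Q

variable {k X}

theorem rbEnd_apply_word (Q : Op) (T : Module.End k (FreeOmega k X)) (w : Word X) :
    rbEnd k X Q T (FreeOmega.word k w) = rbAction k w Q T := by
  rw [← FreeOmega.basis_apply]
  exact (MonoidAlgebra.basis (Word X) k).constr_basis k _ w

theorem rbEnd_apply_of_not_startsWith {Q : Op} {w : Word X} (h : ¬ w.StartsWith Q)
    (T : Module.End k (FreeOmega k X)) :
    rbEnd k X Q T (FreeOmega.word k w) = FreeOmega.op k X Q (T 1) * FreeOmega.word k w := by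
  rw [rbEnd_apply_word]
  cases w with
  | nil => exact (mul_one _).symm
  | consVar x w => rfl
  | consOp Q' v w =>
    rw [rbAction, if_neg (show ¬ Q = Q' from h)]
    rfl

theorem rbEnd_apply_one (Q : Op) (T : Module.End k (FreeOmega k X)) :
    rbEnd k X Q T 1 = FreeOmega.op k X Q (T 1) :=
  (rbEnd_apply_of_not_startsWith (w := 1) (fun h => h) T).trans (mul_one _)

theorem rbEnd_apply_consOp (Q : Op) (v w : Word X) (T : Module.End k (FreeOmega k X)) :
    rbEnd k X Q T (FreeOmega.word k (.consOp Q v w)) =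
      FreeOmega.op k X Q (rbEnd k X Op.R T (FreeOmega.word k v)
        + T (FreeOmega.word k (Word.op Op.S v))) * FreeOmega.word k w := by
  rw [rbEnd_apply_word, rbEnd_apply_word, rbAction, if_pos rfl]
  rfl

/-- The rewriting rule extends linearly from a word `v` to any `z`; this is needed because applying
an operator once already yields a linear combination under `Q`. -/
theorem rbEnd_apply_op_mul (Q : Op) (z : FreeOmega k X) (w : Word X)
    (T : Module.End k (FreeOmega k X)) :
    rbEnd k X Q T (FreeOmega.op k X Q z * FreeOmega.word k w) =
      FreeOmega.op k X Q (rbEnd k X Op.R T z + T (FreeOmega.op k X Op.S z))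
        * FreeOmega.word k w := by
  have h : rbEnd k X Q T ∘ₗ LinearMap.mulRight k (FreeOmega.word k w) ∘ₗ FreeOmega.op k X Q =
      LinearMap.mulRight k (FreeOmega.word k w) ∘ₗ FreeOmega.op k X Q ∘ₗ
        (rbEnd k X Op.R T + T ∘ₗ FreeOmega.op k X Op.S) := by
    refine FreeOmega.linearMap_ext fun v => ?_
    change rbEnd k X Q T (FreeOmega.op k X Q (FreeOmega.word k v) * FreeOmega.word k w) =
      FreeOmega.op k X Q (rbEnd k X Op.R T (FreeOmega.word k v)
        + T (FreeOmega.op k X Op.S (FreeOmega.word k v))) * FreeOmega.word k w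
    rw [FreeOmega.op_word, FreeOmega.op_word, ← FreeOmega.word_mul, ← Word.consOp_eq,
      rbEnd_apply_consOp]
  exact LinearMap.congr_fun h z

theorem rbEnd_apply_op (Q : Op) (z : FreeOmega k X) (T : Module.End k (FreeOmega k X)) :
    rbEnd k X Q T (FreeOmega.op k X Q z) =
      FreeOmega.op k X Q (rbEnd k X Op.R T z + T (FreeOmega.op k X Op.S z)) := by
  simpa only [FreeOmega.word_one, mul_one] using rbEnd_apply_op_mul Q z 1 T

/-- Here `Q(U)` only puts `Q(U 1)` in front of `w`, and `Q(T)` then rewrites against it; `S(U)1 =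
S(U 1)` matches the two sides. -/
theorem rbEnd_mul_rbEnd_of_not_startsWith {Q : Op} {w : Word X} (h : ¬ w.StartsWith Q)
    (T U : Module.End k (FreeOmega k X)) :
    rbEnd k X Q T (rbEnd k X Q U (FreeOmega.word k w)) =
      rbEnd k X Q (rbEnd k X Op.R T * U + T * rbEnd k X Op.S U) (FreeOmega.word k w) := by
  rw [rbEnd_apply_of_not_startsWith h, rbEnd_apply_of_not_startsWith h, rbEnd_apply_op_mul]
  simp only [LinearMap.add_apply, Module.End.mul_apply, rbEnd_apply_one]

/-- On `Q(z)w` both sides have the form `Q(…)w`. The terms under `Q` agree by the identity for `R`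
at the shorter word `z`, together with `S(U)S(z) = S(R(U)z + U S(z))`, which is the rewriting rule
itself. -/
theorem rbEnd_mul_rbEnd (Q : Op) (T U : Module.End k (FreeOmega k X)) :
    rbEnd k X Q T * rbEnd k X Q U =
      rbEnd k X Q (rbEnd k X Op.R T * U + T * rbEnd k X Op.S U) := by
  refine FreeOmega.linearMap_ext fun w => ?_
  rw [Module.End.mul_apply]
  induction w generalizing Q with
  | nil => exact rbEnd_mul_rbEnd_of_not_startsWith (w := .nil) (fun h => h) T U
  | consVar x w _ => exact rbEnd_mul_rbEnd_of_not_startsWith (w := .consVar x w) (fun h => h) T U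
  | consOp Q' z w ihz _ =>
    by_cases hQ : Q = Q'
    · subst hQ
      rw [rbEnd_apply_consOp, rbEnd_apply_consOp, rbEnd_apply_op_mul, ← ihz Op.R]
      simp only [LinearMap.add_apply, Module.End.mul_apply, map_add]
      rw [← FreeOmega.op_word, rbEnd_apply_op]
      simp only [map_add, add_mul]
      abel
    · exact rbEnd_mul_rbEnd_of_not_startsWith (w := .consOp Q' z w) hQ T U

variable (k X) in
theorem isRotaBaxterSystem_rbEnd :
    IsRotaBaxterSystem (rbEnd k X Op.R) (rbEnd k X Op.S) :=
  ⟨rbEnd_mul_rbEnd Op.R, rbEnd_mul_rbEnd Op.S⟩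

theorem interp_rbEnd (Q : Op) : Q.interp (rbEnd k X Op.R) (rbEnd k X Op.S) = rbEnd k X Q := by
  cases Q <;> rfl

variable (k) in
/-- The endomorphism of `k⟨{R, S}; X⟩` by which a word acts; its value at `1` is the normal form of
the word. -/
def wordEnd : Word X →* Module.End k (FreeOmega k X) :=
  Word.evalHom (rbEnd k X Op.R) (rbEnd k X Op.S)
    fun x => LinearMap.mulLeft k (FreeOmega.word k (Word.var x))

theorem wordEnd_consVar (x : X) (w : Word X) (f : FreeOmega k X) :
    wordEnd k (.consVar x w) f = FreeOmega.word k (Word.var x) * wordEnd k w f := rfl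

theorem wordEnd_consOp (Q : Op) (u w : Word X) (f : FreeOmega k X) :
    wordEnd k (.consOp Q u w) f = rbEnd k X Q (wordEnd k u) (wordEnd k w f) := by
  rw [Word.consOp_eq, map_mul, Module.End.mul_apply, wordEnd, Word.evalHom_op, interp_rbEnd]

/-- In a normal word, no `Q(u)` meets a tail starting with `Q`, so the rewriting branch is never
entered. -/
theorem wordEnd_one_of_isNormal {w : Word X} (h : w.IsNormal) :
    wordEnd k w 1 = FreeOmega.word k w := by
  induction w with
  | nil => rfl
  | consVar x w ih => rw [wordEnd_consVar, ih h, ← FreeOmega.word_mul, Word.consVar_eq]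
  | consOp Q u w ihu ihw =>
    rw [wordEnd_consOp, ihw h.2.1, rbEnd_apply_of_not_startsWith h.2.2, ihu h.1,
      FreeOmega.op_word, ← FreeOmega.word_mul, Word.consOp_eq]

theorem RS.linearIndependent_word :
    LinearIndependent k fun w : rbWords X => RS.word k (w : Word X) := by
  -- The normal form map: act on `1`. It carries the classes of normal words to distinct basis
  -- words.
  let N : RS k X →ₗ[k] FreeOmega k X :=
    LinearMap.applyₗ 1 ∘ₗ (RS.lift (isRotaBaxterSystem_rbEnd k X)
      fun x => LinearMap.mulLeft k (FreeOmega.word k (Word.var x))).toLinearMap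
  refine LinearIndependent.of_comp N ?_
  have h : N ∘ (fun w : rbWords X => RS.word k (w : Word X)) =
      MonoidAlgebra.basis (Word X) k ∘ Subtype.val := by
    funext w
    rw [Function.comp_apply, Function.comp_apply, FreeOmega.basis_apply,
      ← wordEnd_one_of_isNormal ((mem_rbWords_iff _).1 w.2)]
    exact congrArg (fun T : Module.End k (FreeOmega k X) => T 1)
      (RS.lift_word (isRotaBaxterSystem_rbEnd k X) _ _)
  rw [h]
  exact (MonoidAlgebra.basis (Word X) k).linearIndependent.comp _ Subtype.val_injective

/-! ### Spanning by normal words -/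

variable (k X) in
/-- The span of the normal words. -/
def normalSpan : Submodule k (FreeOmega k X) :=
  Submodule.span k (FreeOmega.word k '' {w | w.IsNormal})

theorem word_mem_normalSpan {w : Word X} (h : w.IsNormal) : FreeOmega.word k w ∈ normalSpan k X :=
  Submodule.subset_span ⟨w, h, rfl⟩

theorem map_mem_normalSpan {T : Module.End k (FreeOmega k X)}
    (hT : ∀ w : Word X, w.IsNormal → T (FreeOmega.word k w) ∈ normalSpan k X)
    {f : FreeOmega k X} (hf : f ∈ normalSpan k X) : T f ∈ normalSpan k X := by
  have h : normalSpan k X ≤ (normalSpan k X).comap T := by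
    refine Submodule.span_le.2 ?_
    rintro _ ⟨w, hw, rfl⟩
    exact hT w hw
  exact h hf

theorem op_mul_mem_normalSpan {Q : Op} {w : Word X} (hw : w.IsNormal) (hQ : ¬ w.StartsWith Q)
    {f : FreeOmega k X} (hf : f ∈ normalSpan k X) :
    FreeOmega.op k X Q f * FreeOmega.word k w ∈ normalSpan k X := by
  refine map_mem_normalSpan
    (T := LinearMap.mulRight k (FreeOmega.word k w) ∘ₗ FreeOmega.op k X Q) (fun u hu => ?_) hf
  change FreeOmega.op k X Q (FreeOmega.word k u) * FreeOmega.word k w ∈ normalSpan k X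
  rw [FreeOmega.op_word, ← FreeOmega.word_mul]
  exact word_mem_normalSpan (w := .consOp Q u w) ⟨hu, hw, hQ⟩

/-- When `Q(v)w` is rewritten, the new prime `Q(…)` replaces `Q(v)` before the same tail `w`, which
does not start with `Q`; hence no new forbidden pair arises. -/
theorem rbEnd_word_mem_normalSpan {T : Module.End k (FreeOmega k X)}
    (hT : ∀ w : Word X, w.IsNormal → T (FreeOmega.word k w) ∈ normalSpan k X) (Q : Op)
    {w : Word X} (hw : w.IsNormal) : rbEnd k X Q T (FreeOmega.word k w) ∈ normalSpan k X := by
  have h₁ : T 1 ∈ normalSpan k X := hT 1 trivial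
  induction w generalizing Q with
  | nil =>
    rw [rbEnd_apply_of_not_startsWith (w := .nil) (fun h => h)]
    exact op_mul_mem_normalSpan hw (fun h => h) h₁
  | consVar x w _ =>
    rw [rbEnd_apply_of_not_startsWith (w := .consVar x w) (fun h => h)]
    exact op_mul_mem_normalSpan hw (fun h => h) h₁
  | consOp Q' v w ihv _ =>
    by_cases hQ : Q = Q'
    · subst hQ
      rw [rbEnd_apply_consOp]
      exact op_mul_mem_normalSpan hw.2.1 hw.2.2 (Submodule.add_mem _ (ihv Op.R hw.1)
        -- `S(v)` is normal, being a single prime with normal argument.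
        (hT _ ⟨hw.1, trivial, fun h => h⟩))
    · rw [rbEnd_apply_of_not_startsWith (w := .consOp Q' v w) hQ]
      exact op_mul_mem_normalSpan hw hQ h₁

/-- Only `w = 1` is used in the end, but the induction needs every normal `w`, since rewriting
applies the inner action to words such as `S(v)`. -/
theorem wordEnd_mem_normalSpan (u : Word X) {w : Word X} (hw : w.IsNormal) :
    wordEnd k u (FreeOmega.word k w) ∈ normalSpan k X := by
  induction u generalizing w with
  | nil => exact word_mem_normalSpan hw
  | consVar x u ih =>
    rw [wordEnd_consVar]
    refine map_mem_normalSpan (T := LinearMap.mulLeft k (FreeOmega.word k (Word.var x)))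
      (fun v hv => ?_) (ih hw)
    rw [LinearMap.mulLeft_apply, ← FreeOmega.word_mul]
    exact word_mem_normalSpan (w := .consVar x v) hv
  | consOp Q v u ihv ihu =>
    rw [wordEnd_consOp]
    exact map_mem_normalSpan (fun z hz => rbEnd_word_mem_normalSpan (fun _ => ihv) Q hz) (ihu hw)

/-- If `T` induces left multiplication by `t` on the quotient, then `Q(T)` induces left
multiplication by `Q(t)`: each rewriting step is an instance of the Rota-Baxter identity in `RS(X)`.
-/
theorem mk_rbEnd_word {T : Module.End k (FreeOmega k X)} {t : RS k X}
    (hT : ∀ f, OmegaQuotient.mk (rbRelations k X) (T f) = t * OmegaQuotient.mk _ f) (Q : Op)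
    (w : Word X) :
    OmegaQuotient.mk (rbRelations k X) (rbEnd k X Q T (FreeOmega.word k w)) =
      RS.op k X Q t * RS.word k w := by
  have hop : ∀ Q f, OmegaQuotient.mk (rbRelations k X) (FreeOmega.op k X Q f) =
    RS.op k X Q (OmegaQuotient.mk _ f) := fun _ _ => rfl
  have h₁ : OmegaQuotient.mk (rbRelations k X) (T 1) = t := by rw [hT, map_one, mul_one]
  have h₂ : ∀ {Q : Op} {w : Word X}, ¬ w.StartsWith Q →
      OmegaQuotient.mk (rbRelations k X) (rbEnd k X Q T (FreeOmega.word k w)) =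
        RS.op k X Q t * RS.word k w := by
    intro Q w hQ
    rw [rbEnd_apply_of_not_startsWith hQ, map_mul, hop, h₁]
    rfl
  induction w generalizing Q with
  | nil => exact h₂ fun h => h
  | consVar x w _ => exact h₂ fun h => h
  | consOp Q' v w ihv _ =>
    by_cases hQ : Q = Q'
    · subst hQ
      rw [rbEnd_apply_consOp, map_mul, hop, map_add, ihv, hT, Word.consOp_eq, RS.word_mul,
        ← mul_assoc, ← RS.op_word, RS.op_mul_op, RS.op_word]
      rfl
    · exact h₂ hQ

theorem mk_wordEnd (u : Word X) (f : FreeOmega k X) :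
    OmegaQuotient.mk (rbRelations k X) (wordEnd k u f) = RS.word k u * OmegaQuotient.mk _ f := by
  induction u generalizing f with
  | nil => exact (one_mul _).symm
  | consVar x u ih =>
    rw [wordEnd_consVar, map_mul, ih, Word.consVar_eq, RS.word_mul, mul_assoc]
    rfl
  | consOp Q v u ihv ihu =>
    have h : (OmegaQuotient.mk (rbRelations k X)).toLinearMap ∘ₗ rbEnd k X Q (wordEnd k v) =
        LinearMap.mulLeft k (RS.op k X Q (RS.word k v)) ∘ₗ
          (OmegaQuotient.mk (rbRelations k X)).toLinearMap :=
      FreeOmega.linearMap_ext (mk_rbEnd_word ihv Q)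
    have h' := LinearMap.congr_fun h (wordEnd k u f)
    simp only [LinearMap.comp_apply, AlgHom.toLinearMap_apply, LinearMap.mulLeft_apply] at h'
    rw [wordEnd_consOp, h', ihu, RS.op_word, Word.consOp_eq, RS.word_mul, mul_assoc]

theorem RS.span_word :
    ⊤ ≤ Submodule.span k (Set.range fun w : rbWords X => RS.word k (w : Word X)) := by
  rintro a -
  obtain ⟨f, rfl⟩ := OmegaQuotient.mk_surjective _ a
  have hle : normalSpan k X ≤
      (Submodule.span k (Set.range fun w : rbWords X => RS.word k (w : Word X))).comap
        (OmegaQuotient.mk (rbRelations k X)).toLinearMap := by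
    refine Submodule.span_le.2 ?_
    rintro _ ⟨w, hw, rfl⟩
    exact Submodule.subset_span ⟨⟨w, (mem_rbWords_iff w).2 hw⟩, rfl⟩
  have htop : ⊤ ≤ (Submodule.span k (Set.range fun w : rbWords X => RS.word k (w : Word X))).comap
      (OmegaQuotient.mk (rbRelations k X)).toLinearMap := by
    rw [← (MonoidAlgebra.basis (Word X) k).span_eq, Submodule.span_le]
    rintro _ ⟨w, rfl⟩
    -- The class of `w` is the class of its normal form `wordEnd w 1`.
    have h := hle (wordEnd_mem_normalSpan (k := k) w (w := 1) trivial)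
    rw [Submodule.mem_comap, AlgHom.toLinearMap_apply, mk_wordEnd, FreeOmega.word_one, map_one,
      mul_one] at h
    rw [FreeOmega.basis_apply]
    exact h
  exact htop (Submodule.mem_top (x := f))

end Representation

end RotaBaxter

end

open RotaBaxter in
/-- `RS(X) = k⟨{R, S}; X | 𝕊⟩` is the free Rota-Baxter system on `X`; for every well-order on `X`,
`Irr(𝕊) = Φ_∞(X)` with respect to the Deg-lex order; and the classes of the words in `Φ_∞(X)` form a
`k`-linear basis of `RS(X)`. -/
theorem mainTheorem2 {k : Type*} [Field k] {X : Type*} :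
    (IsRotaBaxterSystem (RS.op k X Op.R) (RS.op k X Op.S) ∧
      ∀ (A : Type*) [Ring A] [Algebra k A] (R S : A →ₗ[k] A), IsRotaBaxterSystem R S →
        ∀ φ : X → A, ∃! f : RS k X →ₐ[k] A,
          (∀ x, f (RS.word k (Word.var x)) = φ x) ∧
          (∀ a, f (RS.op k X Op.R a) = R (f a)) ∧
          (∀ a, f (RS.op k X Op.S a) = S (f a))) ∧
    (∀ lt : X → X → Prop, IsWellOrder X lt → Irr lt (rbRelations k X) = rbWords X) ∧
    ∃ b : Module.Basis (rbWords X) k (RS k X), ∀ w : rbWords X, b w = RS.word k (w : Word X) := by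
  refine ⟨⟨RS.isRotaBaxterSystem, fun A _ _ R S h φ => RS.existsUnique_algHom h φ⟩,
    fun lt _ => irr_rbRelations lt,
    Module.Basis.mk RS.linearIndependent_word RS.span_word, fun w => ?_⟩
  rw [Module.Basis.mk_apply]
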